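/- Let $n\ge 1$ and $k\ge 2$. For $x=(x_1,\dots,x_k)\in(\{0,1\}^n)^k$ let $k\text{-}\mathrm{UDISJ}(x)=0$ if $\sum_j x_j(i)\le 1$ for every $i\in[n]$ (a no-instance), and let $k\text{-}\mathrm{UDISJ}(x)=1$ if there is an $\ell\in[n]$ with $x_1(\ell)=\dots=x_k(\ell)=1$ and $\sum_j x_j(i)\le 1$ for every $i\ne\ell$ (a yes-instance); it is undefined on other inputs. The hard distribution $\mathcal P$ is the law of the input $x$ obtained as follows: sample independently and uniformly $\mathcal W_i\in[k]$ and $\mathcal A_i\in\{0,1\}$ for $i\in[n]$, $\mathcal B\in\{0,1\}$, and $\ell\in[n]$; put $x_j(i)=1$ if $\mathcal W_i=j$ and $\mathcal A_i=1$, and $x_j(i)=0$ otherwise; then, if $\mathcal B=1$, change $x_j(\ell)$ to $1$ for all $j\in[k]$. Let $\mathcal Q=(\mathcal P\mid\mathcal B=0)$ and $\mathcal W=(\mathcal W_1,\dots,\mathcal W_n)$. For a deterministic $k$-party communication protocol $C$ (a finite binary tree in which each internal node is owned by a party $j$, who announces a bit depending only on $x_j$, and in which the leaves carry output bits), let $\mathcal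 R_C$ be the leaf rectangle of $C$ that contains the input $x\sim\mathcal Q$, i.e. the set of all inputs that lead to the same leaf as $x$. Theorem. There is an absolute constant $c>0$ such that for all $0<\epsilon<0.0001$, all $n\ge1$ and $k\ge2$, and every deterministic $k$-party protocol $C$ with $\Pr_{x\sim\mathcal P}[C(x)=k\text{-}\mathrm{UDISJ}(x)]\ge 1-\epsilon$, $$\mathcal I(\mathcal Q,\mathcal W:\mathcal R_C)\ \ge\ c\cdot\frac nk ,$$ where $\mathcal I(\mathcal Q,\mathcal W:\mathcal R_C)=\mathcal H(\mathcal Q,\mathcal W)-\mathcal H(\mathcal Q,\mathcal W\mid\mathcal R_C)$ is the mutual information, in bits, between the pair (input drawn from $\mathcal Q$, its hidden variables $\mathcal W$) and $\mathcal R_C$. -/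

import Mathlib

open MeasureTheory ProbabilityTheory

noncomputable section

namespace UDisj

/-- Inputs of `k` parties: `x j` is the characteristic vector of the subset of `[n]` that
party `j` holds. -/
abbrev Input (n k : ℕ) : Type := Fin k → Fin n → Bool

/-- The no instances: every element belongs to at most one set. -/
def noInstances (n k : ℕ) : Set (Input n k) :=
  {x | ∀ i, ∑ j, (x j i).toNat ≤ 1}

/-- The yes instances: one element belongs to all sets, every other element to at most one. -/
def yesInstances (n k : ℕ) : Set (Input n k) :=
  {x | ∃ l, (∀ j, x j l = true) ∧ ∀ i, i ≠ l → ∑ j, (x j i).toNat ≤ 1}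

/-- `b` is the value of `k`-party unique disjointness at `x` (a partial function). -/
def IsUDisjValue {n k : ℕ} (x : Input n k) (b : Bool) : Prop :=
  (x ∈ noInstances n k ∧ b = false) ∨ (x ∈ yesInstances n k ∧ b = true)

/-- Deterministic `k`-party communication protocols (number in hand, shared blackboard) with one
output bit, where every party holds an element of `X`. At a node, its owner `j` announces the bit
`f (x j)`; the protocol continues in the first subtree on `false` and in the second on `true`. -/
inductive Protocol (k : ℕ) (X : Type) : Type where
  | leaf (out : Bool) : Protocol k X
  | node (j : Fin k) (f : X → Bool) (C₀ C₁ : Protocol k X) : Protocol k X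

namespace Protocol

variable {k : ℕ} {X : Type}

/-- The output of a protocol. -/
def output : Protocol k X → (Fin k → X) → Bool
  | leaf out, _ => out
  | node j f C₀ C₁, x => if f (x j) then C₁.output x else C₀.output x

/-- The rectangle of the leaf that is reached on input `x`: all inputs that agree with `x` on
every bit announced along the path of `x`. -/
def leafRect : Protocol k X → (Fin k → X) → Set (Fin k → X)
  | leaf _, _ => Set.univ
  | node j f C₀ C₁, x =>
      {y | f (y j) = f (x j)} ∩ (if f (x j) then C₁.leafRect x else C₀.leafRect x)

end Protocol

/-- The sample space `(W, A, B, ℓ)` of the hard distribution. -/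
abbrev Coins (n k : ℕ) : Type := (Fin n → Fin k) × (Fin n → Bool) × Bool × Fin n

/-- The hidden party choices `W = (W_1, …, W_n)`. -/
def partyChoice {n k : ℕ} (ω : Coins n k) : Fin n → Fin k := ω.1

/-- The bits `A = (A_1, …, A_n)`. -/
def presence {n k : ℕ} (ω : Coins n k) : Fin n → Bool := ω.2.1

/-- The bit `B` that decides whether a common element is planted. -/
def plantBit {n k : ℕ} (ω : Coins n k) : Bool := ω.2.2.1

/-- The position `ℓ` of the common element, if there is one. -/
def plantPos {n k : ℕ} (ω : Coins n k) : Fin n := ω.2.2.2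

/-- The input built from the coins: `x_j(i) = 1` iff `W_i = j` and `A_i = 1`, or `B = 1` and
`i = ℓ`. -/
def sampleInput {n k : ℕ} (ω : Coins n k) : Input n k := fun j i =>
  decide ((partyChoice ω i = j ∧ presence ω i = true) ∨ (plantBit ω = true ∧ i = plantPos ω))

/-- All coins are independent and uniform. -/
def coinLaw (n k : ℕ) : Measure (Coins n k) := uniformOn Set.univ

/-- The hard distribution `P` on inputs. -/
def hardP (n k : ℕ) : Measure (Input n k) := (coinLaw n k).map sampleInput

/-- The law of the coins conditioned on `B = 0`. Under it, `sampleInput` has law `Q`, and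
`(sampleInput, partyChoice)` is the pair `(Q, W)`. -/
def noCoinLaw (n k : ℕ) : Measure (Coins n k) :=
  ProbabilityTheory.cond (coinLaw n k) {ω | plantBit ω = false}

section Information

variable {Ω α β : Type*} [MeasurableSpace Ω] [Fintype α] [Fintype β]

/-- Shannon entropy, in bits, of a random variable with finitely many values. -/
def entropy (μ : Measure Ω) (X : Ω → α) : ℝ :=
  ∑ a, μ.real (X ⁻¹' {a}) * Real.logb 2 (1 / μ.real (X ⁻¹' {a}))

/-- Conditional entropy `H(X | Y)`. -/
def condEntropy (μ : Measure Ω) (X : Ω → α) (Y : Ω → β) : ℝ :=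
  ∑ b, μ.real (Y ⁻¹' {b}) * entropy (ProbabilityTheory.cond μ (Y ⁻¹' {b})) X

/-- Mutual information `I(X : Y) = H(X) - H(X | Y)`. -/
def mutualInfo (μ : Measure Ω) (X : Ω → α) (Y : Ω → β) : ℝ :=
  entropy μ X - condEntropy μ X Y

end Information

/-- `I(Q, W : R_C)`, where `R_C` is the leaf rectangle of `C` that contains the input drawn
from `Q`. -/
def infoCost {n k : ℕ} (C : Protocol k (Fin n → Bool)) : ℝ :=
  mutualInfo (noCoinLaw n k) (fun ω => (sampleInput ω, partyChoice ω))
    (fun ω => C.leafRect (sampleInput ω))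

end UDisj

end

/-! The leaf rectangle is a function of the input, so the information is its entropy, which is at
least the average over w of its entropy given W = w. For fixed w the transcript is a function of
uniform bits, and `sum_one_sub_le_sum_negMulLog_law` bounds its entropy below by half the sum over
positions i of the squared Hellinger distance 1 - ∑ √(pq) between the transcript laws with bit i
equal to 0 and to 1. These are the laws P_0 and P_{e_j}, j = w i, of the transcript with 0 or the
unit vector e_j placed at position i. Neither law depends on w i, so resampling w i turns the
distance into a mean over all k parties; this is the source of 1/k.

It remains to bound the sum over j of these distances below by a constant. Leaves are rectangles
and, given w, the rows of the parties are independent, so P_u is a product over parties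
(`exists_placeLaw_eq_prod`). For such families `sum_sub_two_mul_le` gives P_0(T) - 2 P_1(T) ≤ 320 ∑
h²(P_0, P_{e_j}) with no loss in k: its pointwise form involves the uniform mixture of all P_u,
whose total mass is 1. With T the leaves that output 0, correctness makes the left side at least 1 -
4ε on average (`le_expect_sub_of_correct`). -/

namespace UDisj

/-! ### Inequalities for products of square-root likelihood ratios. -/

section ProductRatio

variable {ι : Type*}

/-- `∏ (1 + v i) ≥ 1 + ∑ (v i - 2 (v i)²)` for `v i ≥ -1/2`, with `v i = (s i - 1) / 2`. -/
lemma one_add_sum_le_prod_half (J : Finset ι) (s : ι → ℝ) (hs : ∀ j, 0 ≤ s j) :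
    1 + ∑ j ∈ J, ((s j - 1) / 2 - (s j - 1) ^ 2 / 2) ≤ ∏ j ∈ J, (1 + s j) / 2 := by
  have hpos : ∀ j, 0 < (1 + s j) / 2 := fun j => by linarith [hs j]
  -- This is log x ≥ 1 - 1/x followed by a comparison of rational functions.
  have hlog : ∀ j, (s j - 1) / 2 - (s j - 1) ^ 2 / 2 ≤ Real.log ((1 + s j) / 2) := by
    intro j
    refine le_trans ?_ (Real.one_sub_inv_le_log_of_pos (hpos j))
    have h1 : 0 < 1 + s j := by linarith [hs j]
    have h2 : 1 - ((1 + s j) / 2)⁻¹ - ((s j - 1) / 2 - (s j - 1) ^ 2 / 2)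
        = (s j - 1) ^ 2 * s j / (2 * (1 + s j)) := by
      field_simp
      ring
    have h3 : 0 ≤ (s j - 1) ^ 2 * s j / (2 * (1 + s j)) := by
      have := hs j
      positivity
    linarith
  calc 1 + ∑ j ∈ J, ((s j - 1) / 2 - (s j - 1) ^ 2 / 2)
      ≤ 1 + ∑ j ∈ J, Real.log ((1 + s j) / 2) := by gcongr with j; exact hlog j
    _ ≤ Real.exp (∑ j ∈ J, Real.log ((1 + s j) / 2)) := by
        rw [add_comm]; exact Real.add_one_le_exp _
    _ = ∏ j ∈ J, (1 + s j) / 2 := by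
        rw [Real.exp_sum]
        exact Finset.prod_congr rfl fun j _ => Real.exp_log (hpos j)

lemma one_sub_sum_le_prod_one_sub (J : Finset ι) (v : ι → ℝ) (h0 : ∀ j ∈ J, 0 ≤ v j)
    (h1 : ∀ j ∈ J, v j ≤ 1) : 1 - ∑ j ∈ J, v j ≤ ∏ j ∈ J, (1 - v j) := by
  classical
  induction J using Finset.induction_on with
  | empty => simp
  | insert a J ha ih =>
    rw [Finset.sum_insert ha, Finset.prod_insert ha]
    have ih' := ih (fun j hj => h0 j (Finset.mem_insert_of_mem hj))
      (fun j hj => h1 j (Finset.mem_insert_of_mem hj))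
    have ha0 := h0 a (Finset.mem_insert_self a J)
    have ha1 := h1 a (Finset.mem_insert_self a J)
    have hs : 0 ≤ ∑ j ∈ J, v j :=
      Finset.sum_nonneg fun j hj => h0 j (Finset.mem_insert_of_mem hj)
    nlinarith [mul_nonneg ha0 hs, mul_le_mul_of_nonneg_left ih' (sub_nonneg.2 ha1)]

/-- Both s² and ((1 + s) / 2)⁴ have slope 2 at s = 1, so a second-order correction suffices. This
bounds ∏ s² by the fourth power of ∏ (1 + s) / 2. -/
lemma half_pow_four_mul_le_sq {s : ℝ} (hs : 0 ≤ s) (h : 2 * (s - 1) ^ 2 ≤ 1) :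
    ((1 + s) / 2) ^ 4 * (1 - 2 * (s - 1) ^ 2) ≤ s ^ 2 := by
  have h1 : ((1 + s) / 2) ^ 2 ≤ (1 + s ^ 2) / 2 := by nlinarith [sq_nonneg (s - 1)]
  have h2 : ((1 + s) / 2) ^ 4 ≤ ((1 + s ^ 2) / 2) ^ 2 := by
    calc ((1 + s) / 2) ^ 4 = (((1 + s) / 2) ^ 2) ^ 2 := by ring
      _ ≤ _ := by gcongr
  have h3 : ((1 + s ^ 2) / 2) ^ 2 * (1 - 2 * (s - 1) ^ 2) ≤ s ^ 2 := by
    have e : s ^ 2 - ((1 + s ^ 2) / 2) ^ 2 * (1 - 2 * (s - 1) ^ 2)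
        = (s - 1) ^ 2 * (2 * (1 + s ^ 2) ^ 2 - (s + 1) ^ 2) / 4 := by ring
    have : 0 ≤ 2 * (1 + s ^ 2) ^ 2 - (s + 1) ^ 2 := by
      nlinarith [sq_nonneg (s - 1), sq_nonneg s, sq_nonneg (s ^ 2)]
    have := mul_nonneg (sq_nonneg (s - 1)) this
    linarith
  have h4 : 0 ≤ 1 - 2 * (s - 1) ^ 2 := by linarith
  exact (mul_le_mul_of_nonneg_right h2 h4).trans h3

/-- If the ratios `s j` are close to `1` in mean square and so is `∏ (1 + s j) / 2`, then
`∏ (s j)²` is at least `1/2`. -/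
lemma one_sub_two_prod_sq_le (J : Finset ι) (s : ι → ℝ) (hs : ∀ j, 0 ≤ s j) :
    1 - 2 * ∏ j ∈ J, s j ^ 2
      ≤ 64 * (∑ j ∈ J, (s j - 1) ^ 2 + (∏ j ∈ J, (1 + s j) / 2 - 1) ^ 2) := by
  set V := ∑ j ∈ J, (s j - 1) ^ 2 with hV
  set F := ∏ j ∈ J, (1 + s j) / 2 with hF
  have hB : 0 ≤ ∏ j ∈ J, s j ^ 2 := Finset.prod_nonneg fun j _ => sq_nonneg _
  have hV0 : 0 ≤ V := Finset.sum_nonneg fun j _ => sq_nonneg _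
  -- If V ≥ 1/16 or F ≤ 7/8, the right side is already at least 1. Otherwise ∏ s² ≥ (7/8)⁵ > 1/2 and
  -- the left side is negative.
  by_cases hV1 : 1 / 16 ≤ V
  · nlinarith [sq_nonneg (F - 1)]
  by_cases hF1 : F ≤ 7 / 8
  · nlinarith
  push Not at hV1 hF1
  have hj : ∀ j ∈ J, 2 * (s j - 1) ^ 2 ≤ 1 := fun j hj => by
    have := Finset.single_le_sum (f := fun j => (s j - 1) ^ 2) (fun j _ => sq_nonneg _) hj
    linarith
  have h1 : F ^ 4 * (1 - 2 * V) ≤ ∏ j ∈ J, s j ^ 2 := by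
    calc F ^ 4 * (1 - 2 * V)
        ≤ F ^ 4 * ∏ j ∈ J, (1 - 2 * (s j - 1) ^ 2) := by
          gcongr
          rw [hV, Finset.mul_sum]
          exact one_sub_sum_le_prod_one_sub J _ (fun j _ => by positivity) hj
      _ = ∏ j ∈ J, (((1 + s j) / 2) ^ 4 * (1 - 2 * (s j - 1) ^ 2)) := by
          rw [Finset.prod_mul_distrib, Finset.prod_pow]
      _ ≤ ∏ j ∈ J, s j ^ 2 := by
          refine Finset.prod_le_prod (fun j h => ?_)
            fun j h => half_pow_four_mul_le_sq (hs j) (hj j h)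
          have := hj j h
          exact mul_nonneg (by positivity) (by linarith)
  have h2 : (7 / 8 : ℝ) ^ 4 ≤ F ^ 4 := by gcongr
  have h3 : (7 / 8 : ℝ) ^ 4 * (7 / 8) ≤ F ^ 4 * (1 - 2 * V) := by
    gcongr
    linarith
  have : 0 ≤ 64 * (V + (F - 1) ^ 2) := by positivity
  norm_num at h3
  linarith

/-- Expand (F - 1)² for F = ∏ (1 + s) / 2, with F² bounded above factor by factor and F below by
`one_add_sum_le_prod_half`. After multiplication by P_0, every term on the right can be summed over
transcripts. -/
lemma sum_sq_add_sq_le (J : Finset ι) (s : ι → ℝ) (hs : ∀ j, 0 ≤ s j) :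
    ∑ j ∈ J, (s j - 1) ^ 2 + (∏ j ∈ J, (1 + s j) / 2 - 1) ^ 2
      ≤ ∏ j ∈ J, (1 + s j ^ 2) / 2 - 1 + ∑ j ∈ J, (2 * s j ^ 2 - 5 * s j + 3) := by
  have h1 := one_add_sum_le_prod_half J s hs
  have h2 : (∏ j ∈ J, (1 + s j) / 2) ^ 2 ≤ ∏ j ∈ J, (1 + s j ^ 2) / 2 := by
    rw [← Finset.prod_pow]
    exact Finset.prod_le_prod (fun j _ => sq_nonneg _)
      fun j _ => by nlinarith [sq_nonneg (s j - 1)]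
  have h3 : ∑ j ∈ J, (2 * s j ^ 2 - 5 * s j + 3)
      = ∑ j ∈ J, (s j - 1) ^ 2 - 2 * ∑ j ∈ J, ((s j - 1) / 2 - (s j - 1) ^ 2 / 2) := by
    rw [Finset.mul_sum, ← Finset.sum_sub_distrib]
    exact Finset.sum_congr rfl fun j _ => by ring
  rw [h3]
  nlinarith

end ProductRatio

/-! ### Hellinger distances within a product family. -/

section ProductKernel

variable {ι τ : Type*} [Fintype ι] [DecidableEq ι] [Fintype τ]

/-- The pointwise bound behind `sum_sub_two_mul_le`, for nonnegative weights `a j`, `b j`. -/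
lemma prod_sub_two_prod_le (a b : ι → ℝ) (ha : ∀ j, 0 ≤ a j) (hb : ∀ j, 0 ≤ b j)
    (e : ι → ℝ) (he : ∀ j, e j = b j * ∏ i ∈ Finset.univ.erase j, a i) :
    max 0 (∏ j, a j - 2 * ∏ j, b j)
      ≤ 64 * (∏ j, (a j + b j) / 2 - ∏ j, a j
          + ∑ j, (2 * e j - 5 * √((∏ i, a i) * e j) + 3 * ∏ i, a i)) := by
  have he0 : ∀ j, 0 ≤ e j := fun j => by
    rw [he]
    exact mul_nonneg (hb j) (Finset.prod_nonneg fun i _ => ha i)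
  by_cases h0 : ∏ j, a j = 0
  · have hB : 0 ≤ ∏ j, b j := Finset.prod_nonneg fun j _ => hb j
    have hK : 0 ≤ ∏ j, (a j + b j) / 2 :=
      Finset.prod_nonneg fun j _ => by linarith [ha j, hb j]
    simp only [h0, zero_mul, Real.sqrt_zero, mul_zero, sub_zero, add_zero]
    have : 0 ≤ ∑ j, 2 * e j := Finset.sum_nonneg fun j _ => by linarith [he0 j]
    refine max_le ?_ ?_ <;> linarith
  have hpos : ∀ j, 0 < a j := fun j =>
    lt_of_le_of_ne (ha j) fun h => h0 (Finset.prod_eq_zero (Finset.mem_univ j) h.symm)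
  set A := ∏ j, a j with hA
  have hA0 : 0 < A := Finset.prod_pos fun j _ => hpos j
  -- Dividing by A leaves only the likelihood ratios of single parties.
  set s : ι → ℝ := fun j => √(b j / a j) with hs
  have hs0 : ∀ j, 0 ≤ s j := fun j => Real.sqrt_nonneg _
  have hs2 : ∀ j, s j ^ 2 = b j / a j := fun j =>
    Real.sq_sqrt (div_nonneg (hb j) (ha j))
  have hej : ∀ j, e j = A * s j ^ 2 := fun j => by
    rw [he, hs2, hA, ← Finset.mul_prod_erase Finset.univ a (Finset.mem_univ j)]
    field_simp [(hpos j).ne']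
  have hsq : ∀ j, √(A * e j) = A * s j := fun j => by
    rw [hej, ← mul_assoc, ← sq, ← mul_pow]
    exact Real.sqrt_sq (mul_nonneg hA0.le (hs0 j))
  have hK : ∏ j, (a j + b j) / 2 = A * ∏ j, (1 + s j ^ 2) / 2 := by
    rw [hA, ← Finset.prod_mul_distrib]
    refine Finset.prod_congr rfl fun j _ => ?_
    rw [hs2]
    field_simp [(hpos j).ne']
  have hB : ∏ j, b j = A * ∏ j, s j ^ 2 := by
    rw [hA, ← Finset.prod_mul_distrib]
    refine Finset.prod_congr rfl fun j _ => ?_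
    rw [hs2]
    field_simp [(hpos j).ne']
  have hS : ∑ j, (2 * e j - 5 * √(A * e j) + 3 * A)
      = A * ∑ j, (2 * s j ^ 2 - 5 * s j + 3) := by
    rw [Finset.mul_sum]
    refine Finset.sum_congr rfl fun j _ => ?_
    rw [hsq, hej]
    ring
  rw [hK, hB, hS]
  have h1 := one_sub_two_prod_sq_le Finset.univ s hs0
  have h2 := sum_sq_add_sq_le Finset.univ s hs0
  have h3 : 0 ≤ ∑ j, (s j - 1) ^ 2 + (∏ j, (1 + s j) / 2 - 1) ^ 2 :=
    add_nonneg (Finset.sum_nonneg fun j _ => sq_nonneg _) (sq_nonneg _)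
  refine max_le ?_ ?_
  · have := mul_nonneg hA0.le (h3.trans h2)
    linarith
  · have := mul_le_mul_of_nonneg_left (h1.trans (mul_le_mul_of_nonneg_left h2 (by norm_num)))
      hA0.le
    linarith

/-- Let `P u`, `u ∈ {0,1}^ι`, be probability distributions on `τ` with the product structure
`P u t = ∏ j, q j (u j) t` of transcript distributions. If each `P (e_j)` is close to `P 0` in
Hellinger distance, then `P 1` is not much smaller than `P 0` on any event. -/
lemma sum_sub_two_mul_le (P : (ι → Bool) → τ → ℝ) (q : ι → Bool → τ → ℝ)
    (hq : ∀ j b t, 0 ≤ q j b t) (hP : ∀ u t, P u t = ∏ j, q j (u j) t)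
    (hsum : ∀ u, ∑ t, P u t = 1) (T : Finset τ) :
    ∑ t ∈ T, P (fun _ => false) t - 2 * ∑ t ∈ T, P (fun _ => true) t
      ≤ 320 * ∑ j, (1 - ∑ t, √(P (fun _ => false) t * P (fun i => decide (i = j)) t)) := by
  set Z : τ → ℝ := fun t => 64 * ((∏ j, (q j false t + q j true t) / 2) - P (fun _ => false) t
      + ∑ j, (2 * P (fun i => decide (i = j)) t
        - 5 * √(P (fun _ => false) t * P (fun i => decide (i = j)) t)
        + 3 * P (fun _ => false) t)) with hZ
  -- The maximum with 0 makes Z nonnegative, so the sum over T can be extended to all t.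
  have key : ∀ t, max 0 (P (fun _ => false) t - 2 * P (fun _ => true) t) ≤ Z t := by
    intro t
    have := prod_sub_two_prod_le (fun j => q j false t) (fun j => q j true t)
      (fun j => hq _ _ _) (fun j => hq _ _ _) (fun j => P (fun i => decide (i = j)) t)
      (fun j => by
        rw [hP, ← Finset.mul_prod_erase Finset.univ _ (Finset.mem_univ j)]
        simp only [decide_true]
        congr 1
        refine Finset.prod_congr rfl fun i hi => ?_
        simp [Finset.ne_of_mem_erase hi])
    simpa only [hZ, hP] using this
  -- The product of the averages is the uniform mixture of the P u. Hence it cancels against P 0 in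
  -- the sum of Z, leaving 64 · (2 + 3) = 320.
  have hK : ∑ t, ∏ j, (q j false t + q j true t) / 2 = 1 := by
    have h : ∀ t, ∏ j, (q j false t + q j true t) / 2
        = ((2 : ℝ) ^ Fintype.card ι)⁻¹ * ∑ u : ι → Bool, P u t := by
      intro t
      simp_rw [hP]
      rw [Finset.prod_div_distrib, Finset.prod_const, Finset.card_univ, div_eq_inv_mul]
      congr 1
      have := Finset.prod_univ_sum (fun _ : ι => (Finset.univ : Finset Bool))
        (fun j b => q j b t)
      rw [Fintype.piFinset_univ] at this
      rw [← this]
      exact Finset.prod_congr rfl fun j _ => by simp [add_comm]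
    simp_rw [h]
    rw [← Finset.mul_sum, Finset.sum_comm]
    simp [hsum]
  calc ∑ t ∈ T, P (fun _ => false) t - 2 * ∑ t ∈ T, P (fun _ => true) t
      = ∑ t ∈ T, (P (fun _ => false) t - 2 * P (fun _ => true) t) := by
        rw [Finset.sum_sub_distrib, Finset.mul_sum]
    _ ≤ ∑ t ∈ T, Z t := Finset.sum_le_sum fun t _ => (le_max_right _ _).trans (key t)
    _ ≤ ∑ t, Z t := Finset.sum_le_sum_of_subset_of_nonneg (Finset.subset_univ T)
        fun t _ _ => (le_max_left _ _).trans (key t)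
    _ = _ := by
        simp only [hZ]
        rw [← Finset.mul_sum, Finset.sum_add_distrib, Finset.sum_sub_distrib, hK, hsum,
          Finset.sum_comm]
        simp_rw [Finset.sum_add_distrib, Finset.sum_sub_distrib, ← Finset.mul_sum, hsum]
        simp only [Finset.sum_const, Finset.card_univ, nsmul_eq_mul]
        ring

end ProductKernel

/-! ### Mutual information with a function of the variable. -/

section MutualInfo

variable {Ω α β : Type*} [MeasurableSpace Ω] [DiscreteMeasurableSpace Ω] [Fintype α] [Fintype β]

lemma sum_measureReal_preimage_comp (μ : Measure Ω) [IsFiniteMeasure μ] (X : Ω → α) (f : α → β)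
    (φ : β → ℝ) :
    ∑ a, μ.real (X ⁻¹' {a}) * φ (f a) = ∑ b, μ.real ((fun ω => f (X ω)) ⁻¹' {b}) * φ b := by
  classical
  have h : ∀ b, μ.real ((fun ω => f (X ω)) ⁻¹' {b})
      = ∑ a with f a = b, μ.real (X ⁻¹' {a}) := by
    intro b
    rw [← measureReal_biUnion_finset]
    · congr 1
      ext ω
      simp
    · intro a _ a' _ haa
      exact Disjoint.preimage X (by simpa using haa)
    · intro a _
      exact MeasurableSet.of_discrete
  simp_rw [h, Finset.sum_mul]
  rw [← Finset.sum_fiberwise Finset.univ f]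
  refine Finset.sum_congr rfl fun b _ => Finset.sum_congr rfl fun a ha => ?_
  rw [(Finset.mem_filter.1 ha).2]

/-- The information between `X` and a function of `X` is the entropy of that function. -/
lemma mutualInfo_comp (μ : Measure Ω) [IsFiniteMeasure μ] (X : Ω → α) (f : α → β) :
    mutualInfo μ X (fun ω => f (X ω)) = entropy μ (fun ω => f (X ω)) := by
  classical
  set Y : Ω → β := fun ω => f (X ω) with hY
  have hle : ∀ a, μ.real (X ⁻¹' {a}) ≤ μ.real (Y ⁻¹' {f a}) := fun a =>
    measureReal_mono fun ω hω => by
      simp only [Set.mem_preimage, Set.mem_singleton_iff] at hω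
      simp [hY, hω]
  have hcond : ∀ b a, (ProbabilityTheory.cond μ (Y ⁻¹' {b})).real (X ⁻¹' {a})
      = if f a = b then (μ.real (Y ⁻¹' {b}))⁻¹ * μ.real (X ⁻¹' {a}) else 0 := by
    intro b a
    rw [measureReal_def, cond_apply MeasurableSet.of_discrete, ENNReal.toReal_mul,
      ENNReal.toReal_inv]
    split_ifs with h
    · rw [Set.inter_eq_right.2, measureReal_def, measureReal_def]
      intro ω hω
      simp only [Set.mem_preimage, Set.mem_singleton_iff] at hω
      simp [hY, hω, h]
    · have : Y ⁻¹' {b} ∩ X ⁻¹' {a} = ∅ := by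
        ext ω
        simp only [Set.mem_inter_iff, Set.mem_preimage, Set.mem_singleton_iff,
          Set.mem_empty_iff_false, iff_false, not_and, hY]
        rintro h1 h2
        exact h (h2 ▸ h1)
      simp [this]
  have hc : condEntropy μ X Y = ∑ a, μ.real (X ⁻¹' {a})
      * Real.logb 2 (μ.real (Y ⁻¹' {f a}) / μ.real (X ⁻¹' {a})) := by
    unfold condEntropy entropy
    simp_rw [Finset.mul_sum]
    rw [Finset.sum_comm]
    refine Finset.sum_congr rfl fun a _ => ?_
    rw [Finset.sum_eq_single (f a)]
    · rw [hcond, if_pos rfl]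
      by_cases h0 : μ.real (Y ⁻¹' {f a}) = 0
      · have : μ.real (X ⁻¹' {a}) = 0 := le_antisymm (h0 ▸ hle a) measureReal_nonneg
        simp [this]
      · rw [← mul_assoc, mul_inv_cancel_left₀ h0, one_div, mul_inv, inv_inv, div_eq_mul_inv]
    · intro b _ hb
      rw [hcond, if_neg hb.symm]
      simp
    · simp
  rw [mutualInfo, hc, entropy, ← Finset.sum_sub_distrib, entropy,
    ← sum_measureReal_preimage_comp μ X f
      (fun b => Real.logb 2 (1 / μ.real ((fun ω => f (X ω)) ⁻¹' {b})))]
  refine Finset.sum_congr rfl fun a _ => ?_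
  by_cases h0 : μ.real (X ⁻¹' {a}) = 0
  · simp [h0]
  · have h1 : μ.real (Y ⁻¹' {f a}) ≠ 0 := by
      intro h
      exact h0 (le_antisymm (h ▸ hle a) measureReal_nonneg)
    rw [← mul_sub, ← Real.logb_div (by simpa using h0) (div_ne_zero h1 h0)]
    change _ = _ * Real.logb 2 (1 / μ.real (Y ⁻¹' {f a}))
    congr 2
    field_simp

end MutualInfo

/-! ### Subadditivity of entropy with a Hellinger loss. -/

section Subadditivity

variable {ι : Type*}

open Finset

/-- Apply log y ≥ 1 - 1/y at y = √x, so that square roots appear in the entropy deficit. -/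
lemma two_mul_sub_two_mul_sqrt_le_mul_log {x : ℝ} (hx : 0 ≤ x) :
    2 * x - 2 * √x ≤ x * Real.log x := by
  rcases hx.eq_or_lt with rfl | h
  · simp
  have h1 := Real.one_sub_inv_le_log_of_pos (Real.sqrt_pos.2 h)
  rw [Real.log_sqrt hx] at h1
  have h2 : x * (√x)⁻¹ = √x := by
    rw [← div_eq_mul_inv, Real.div_sqrt]
  nlinarith [mul_le_mul_of_nonneg_left h1 hx]

/-- A lower bound for `log 2 - h(p, q)`, `p + q = 1`, in nats. -/
lemma one_sub_le_sum_mul_log {p q : ℝ} (hp : 0 ≤ p) (hq : 0 ≤ q) (hpq : p + q = 1) :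
    (1 - 2 * √(p * q)) / 2 ≤ p * Real.log (2 * p) + q * Real.log (2 * q) := by
  have h1 := two_mul_sub_two_mul_sqrt_le_mul_log (x := 2 * p) (by positivity)
  have h2 := two_mul_sub_two_mul_sqrt_le_mul_log (x := 2 * q) (by positivity)
  have h3 : 2 * √(p * q) = √(2 * p) * √(2 * q) := by
    rw [← Real.sqrt_mul (by positivity : 0 ≤ 2 * p), show 2 * p * (2 * q) = 2 ^ 2 * (p * q) by ring,
      Real.sqrt_mul (by norm_num : (0 : ℝ) ≤ 2 ^ 2), Real.sqrt_sq (by norm_num)]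
  have h4 := Real.sq_sqrt (show 0 ≤ 2 * p by positivity)
  have h5 := Real.sq_sqrt (show 0 ≤ 2 * q by positivity)
  rw [h3]
  nlinarith [sq_nonneg (√(2 * p) + √(2 * q) - 2)]

/-- The number of points of `T` whose coordinate `i` is `b`. -/
def coordCount (T : Finset (ι → Bool)) (i : ι) (b : Bool) : ℝ := #{a ∈ T | a i = b}

lemma coordCount_nonneg (T : Finset (ι → Bool)) (i : ι) (b : Bool) : 0 ≤ coordCount T i b :=
  Nat.cast_nonneg _

lemma coordCount_add (T : Finset (ι → Bool)) (i : ι) :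
    coordCount T i false + coordCount T i true = #T := by
  unfold coordCount
  rw [← Nat.cast_add]
  congr 1
  have := card_filter_add_card_filter_not (s := T) (fun a => a i = false)
  simpa using this

lemma sum_comp_coord (T : Finset (ι → Bool)) (i : ι) (φ : Bool → ℝ) :
    ∑ a ∈ T, φ (a i) = coordCount T i false * φ false + coordCount T i true * φ true := by
  rw [← sum_fiberwise T (fun a => a i), Fintype.sum_bool, add_comm]
  unfold coordCount
  congr 1 <;>
  · rw [← nsmul_eq_mul, ← sum_const]
    exact sum_congr rfl fun a ha => by rw [(mem_filter.1 ha).2]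

/-- Subadditivity of entropy for the uniform distribution on `T`, with the loss of each coordinate
bounded below by a squared Hellinger distance. -/
lemma sum_sub_sqrt_le_card_mul_log [Fintype ι] (T : Finset (ι → Bool)) :
    ∑ i, (#T - 2 * √(coordCount T i false * coordCount T i true)) / 2
      ≤ #T * (Fintype.card ι * Real.log 2 - Real.log #T) := by
  classical
  rcases T.eq_empty_or_nonempty with rfl | hT
  · simp [coordCount]
  set N : ℝ := (#T : ℝ) with hN
  have hN0 : 0 < N := Nat.cast_pos.2 hT.card_pos
  set p : ι → Bool → ℝ := fun i b => coordCount T i b / N with hp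
  have hp0 : ∀ i b, 0 ≤ p i b := fun i b => div_nonneg (coordCount_nonneg T i b) hN0.le
  have hp1 : ∀ i, p i false + p i true = 1 := fun i => by
    rw [hp, ← add_div, coordCount_add, div_self hN0.ne']
  have hpos : ∀ a ∈ T, ∀ i, 0 < p i (a i) := by
    intro a ha i
    refine div_pos ?_ hN0
    exact Nat.cast_pos.2 (card_pos.2 ⟨a, by simp [ha]⟩)
  have hcoord : ∀ i, (N - 2 * √(coordCount T i false * coordCount T i true)) / 2
      ≤ ∑ a ∈ T, Real.log (2 * p i (a i)) := by
    intro i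
    rw [sum_comp_coord T i (fun b => Real.log (2 * p i b))]
    have h1 := mul_le_mul_of_nonneg_left
      (one_sub_le_sum_mul_log (hp0 i false) (hp0 i true) (hp1 i)) hN0.le
    have h2 : ∀ b, coordCount T i b = N * p i b := fun b => by
      simp only [hp]
      rw [mul_div_cancel₀ _ hN0.ne']
    have h3 : √(coordCount T i false * coordCount T i true) = N * √(p i false * p i true) := by
      rw [h2, h2, show N * p i false * (N * p i true) = N ^ 2 * (p i false * p i true) by ring,
        Real.sqrt_mul (sq_nonneg N), Real.sqrt_sq hN0.le]
    rw [h3, h2 false, h2 true]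
    linarith
  have hprod : ∑ a : ι → Bool, ∏ i, p i (a i) = 1 := by
    have := prod_univ_sum (fun _ : ι => (univ : Finset Bool)) p
    rw [Fintype.piFinset_univ] at this
    rw [← this]
    exact prod_eq_one fun i _ => by rw [Fintype.sum_bool, add_comm, hp1]
  -- Gibbs' inequality for the uniform law on T against the product of its marginals.
  have hgibbs : ∑ a ∈ T, Real.log (N * ∏ i, p i (a i)) ≤ 0 := by
    calc ∑ a ∈ T, Real.log (N * ∏ i, p i (a i))
        ≤ ∑ a ∈ T, (N * ∏ i, p i (a i) - 1) := sum_le_sum fun a ha =>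
          Real.log_le_sub_one_of_pos (mul_pos hN0 (prod_pos fun i _ => hpos a ha i))
      _ = N * ∑ a ∈ T, ∏ i, p i (a i) - N := by
          rw [sum_sub_distrib, ← mul_sum]
          simp [hN]
      _ ≤ N * ∑ a : ι → Bool, ∏ i, p i (a i) - N := by
          gcongr
          · exact fun a _ _ => prod_nonneg fun i _ => hp0 i _
          exact subset_univ T
      _ = 0 := by rw [hprod]; ring
  have hsplit : ∑ a ∈ T, Real.log (N * ∏ i, p i (a i))
      = N * Real.log N + (∑ i, ∑ a ∈ T, Real.log (2 * p i (a i)))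
        - N * (Fintype.card ι * Real.log 2) := by
    rw [sum_comm]
    have : ∀ a ∈ T, Real.log (N * ∏ i, p i (a i)) = Real.log N
        + ∑ i, Real.log (2 * p i (a i)) - Fintype.card ι * Real.log 2 := by
      intro a ha
      rw [Real.log_mul hN0.ne' (prod_pos fun i _ => hpos a ha i).ne',
        Real.log_prod fun i _ => (hpos a ha i).ne']
      have : ∀ i, Real.log (2 * p i (a i)) = Real.log 2 + Real.log (p i (a i)) := fun i =>
        Real.log_mul two_ne_zero (hpos a ha i).ne'
      simp_rw [this, sum_add_distrib]
      simp only [sum_const, card_univ, nsmul_eq_mul]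
      ring
    rw [sum_congr rfl this, sum_sub_distrib, sum_add_distrib]
    simp [hN]
  have := sum_le_sum fun i (_ : i ∈ univ) => hcoord i
  linarith

end Subadditivity

/-! ### Averages over independent uniform coordinates. -/

section Expectation

open Finset
open scoped BigOperators

variable {ι κ α τ : Type*} [Fintype ι] [DecidableEq ι] [Fintype κ] [Fintype α]

/-- Rerandomizing one coordinate of a uniform function leaves it uniform. -/
lemma expect_update [DecidableEq κ] (i : ι) (f : (ι → κ) → ℝ) :
    𝔼 w : ι → κ, 𝔼 j, f (Function.update w i j) = 𝔼 w, f w := by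
  rcases isEmpty_or_nonempty κ with h | h
  · have : IsEmpty (ι → κ) := ⟨fun w => h.elim (w i)⟩
    simp
  rw [← expect_product' univ univ (fun w j => f (Function.update w i j)), univ_product_univ]
  -- The involution swaps coordinate i with the fresh value.
  let e : (ι → κ) × κ ≃ (ι → κ) × κ := Function.Involutive.toPerm
    (fun x => (Function.update x.1 i x.2, x.1 i)) fun x => by simp
  rw [show 𝔼 x : (ι → κ) × κ, f (Function.update x.1 i x.2) = 𝔼 x : (ι → κ) × κ, f x.1 from
      Fintype.expect_equiv e _ (fun x => f x.1) fun x => rfl, ← univ_product_univ,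
    expect_product' univ univ (fun w _ => f w)]
  exact expect_congr rfl fun w _ => expect_const univ_nonempty _

lemma expect_prod_pi [DecidableEq κ] (f : κ → α → ℝ) :
    𝔼 a : κ → α, ∏ j, f j (a j) = ∏ j, 𝔼 b, f j b := by
  rw [Fintype.expect_eq_sum_div_card]
  simp_rw [Fintype.expect_eq_sum_div_card]
  rw [prod_div_distrib, Fintype.prod_sum]
  simp

/-- Functions of disjoint blocks of independent uniform bits are independent. -/
lemma expect_prod_of_blocks [DecidableEq κ] (w : ι → κ) (f : κ → (ι → Bool) → ℝ)
    (hf : ∀ j a a', (∀ i, w i = j → a i = a' i) → f j a = f j a') :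
    𝔼 a, ∏ j, f j a = ∏ j, 𝔼 a, f j a := by
  rw [← expect_prod_pi]
  set G : (ι → Bool) → ℝ := fun a => ∏ j, f j a with hG
  have h1 : ∀ aa : κ → ι → Bool, ∏ j, f j (aa j) = G fun i => aa (w i) i := fun aa =>
    prod_congr rfl fun j _ => hf j _ _ fun i hi => by rw [hi]
  simp_rw [h1]
  -- Each block j reads its own copy aa j. The selection i ↦ aa (w i) i is uniform: XOR with a
  -- common a preserves the law of aa, and for fixed aa the XOR with a uniform a is uniform.
  have h2 : ∀ a : ι → Bool, 𝔼 aa : κ → ι → Bool, G (fun i => aa (w i) i)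
      = 𝔼 aa : κ → ι → Bool, G (fun i => (aa (w i) i ^^ a i)) := fun a =>
    (Fintype.expect_equiv (Function.Involutive.toPerm
      (fun (aa : κ → ι → Bool) j i => (aa j i ^^ a i)) fun aa => by ext; simp) _ _
      fun aa => rfl).symm
  have h3 : ∀ b : ι → Bool, 𝔼 a : ι → Bool, G (fun i => (b i ^^ a i)) = 𝔼 a, G a := fun b =>
    Fintype.expect_equiv (Function.Involutive.toPerm
      (fun (a : ι → Bool) (i : ι) => (b i ^^ a i)) fun a => by ext; simp) _ _ fun a => rfl
  symm
  calc 𝔼 aa : κ → ι → Bool, G (fun i => aa (w i) i)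
      = 𝔼 _a : ι → Bool, 𝔼 aa : κ → ι → Bool, G (fun i => aa (w i) i) :=
        (Fintype.expect_const _).symm
    _ = 𝔼 a : ι → Bool, 𝔼 aa : κ → ι → Bool, G (fun i => (aa (w i) i ^^ a i)) :=
        expect_congr rfl fun a _ => h2 a
    _ = 𝔼 aa : κ → ι → Bool, 𝔼 a : ι → Bool, G (fun i => (aa (w i) i ^^ a i)) :=
        expect_comm _ _ _
    _ = 𝔼 aa : κ → ι → Bool, 𝔼 a, G a := expect_congr rfl fun aa _ => h3 _
    _ = 𝔼 a, G a := Fintype.expect_const _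

/-- The probability that a function of a uniform element takes the value `t`. -/
noncomputable def law [DecidableEq τ] (g : α → τ) (t : τ) : ℝ := 𝔼 a, if g a = t then 1 else 0

lemma law_nonneg [DecidableEq τ] (g : α → τ) (t : τ) : 0 ≤ law g t :=
  expect_nonneg fun a _ => by split_ifs <;> norm_num

lemma sum_law [Fintype τ] [DecidableEq τ] [Nonempty α] (g : α → τ) : ∑ t, law g t = 1 := by
  unfold law
  rw [← expect_sum_comm]
  simp

lemma law_eq_card_div [DecidableEq τ] (g : α → τ) (t : τ) :
    law g t = #{a | g a = t} / (Fintype.card α : ℝ) := by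
  rw [law, Fintype.expect_eq_sum_div_card]
  simp

lemma sum_law_mem [DecidableEq τ] (g : α → τ) (T : Finset τ) :
    ∑ t ∈ T, law g t = 𝔼 a, if g a ∈ T then 1 else 0 := by
  unfold law
  rw [← expect_sum_comm]
  simp

/-- The entropy of a function of uniform bits is at least the sum of the squared Hellinger distances
between its conditional laws given the two values of each bit. -/
lemma sum_one_sub_le_sum_negMulLog_law [Fintype τ] [DecidableEq τ] (g : (ι → Bool) → τ) :
    ∑ i, (1 - ∑ t, √(law (fun a => g (Function.update a i false)) t
        * law (fun a => g (Function.update a i true)) t)) / 2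
      ≤ ∑ t, Real.negMulLog (law g t) := by
  set M : ℝ := 2 ^ Fintype.card ι with hM
  have hM0 : 0 < M := by positivity
  have hcard : (Fintype.card (ι → Bool) : ℝ) = M := by simp [hM]
  set T : τ → Finset (ι → Bool) := fun t => {a | g a = t} with hT
  have hlaw : ∀ t, law g t = #(T t) / M := fun t => by rw [law_eq_card_div, hcard]
  -- Forcing bit i to b amounts to conditioning on an event of probability 1/2, hence the factor 2.
  have hupd : ∀ i b t, law (fun a => g (Function.update a i b)) t
      = 2 * coordCount (T t) i b / M := by
    intro i b t
    have h1 := expect_update i (fun a : ι → Bool => if g a = t ∧ a i = b then (1 : ℝ) else 0)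
    simp only [Function.update_self] at h1
    have h2 : ∀ w : ι → Bool,
        𝔼 j, (if g (Function.update w i j) = t ∧ j = b then (1 : ℝ) else 0)
          = (if g (Function.update w i b) = t then 1 else 0) / 2 := by
      intro w
      rw [Fintype.expect_eq_sum_div_card, Fintype.card_bool, Fintype.sum_bool]
      cases b <;> simp
    simp_rw [h2] at h1
    rw [← expect_div, Fintype.expect_eq_sum_div_card (fun a => if g a = t ∧ a i = b then
      (1 : ℝ) else 0), hcard] at h1
    have h3 : coordCount (T t) i b = ∑ a, if g a = t ∧ a i = b then (1 : ℝ) else 0 := by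
      simp [coordCount, hT, filter_filter]
    rw [law, h3]
    linarith [mul_div_assoc 2 (∑ a, if g a = t ∧ a i = b then (1 : ℝ) else 0) M]
  have hsqrt : ∀ i t, √(law (fun a => g (Function.update a i false)) t
        * law (fun a => g (Function.update a i true)) t)
      = 2 * √(coordCount (T t) i false * coordCount (T t) i true) / M := by
    intro i t
    rw [hupd, hupd, show ∀ x y : ℝ, 2 * x / M * (2 * y / M) = (2 / M) ^ 2 * (x * y) from
      fun x y => by ring, Real.sqrt_mul (by positivity), Real.sqrt_sq (by positivity)]
    ring
  -- The entropy of g is the mean entropy deficit of the uniform laws on its fibers, so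
  -- subadditivity applies fiber by fiber.
  have hent : ∀ t, Real.negMulLog (law g t)
      = #(T t) * (Fintype.card ι * Real.log 2 - Real.log #(T t)) / M := by
    intro t
    rw [hlaw, Real.negMulLog]
    rcases eq_or_ne (#(T t) : ℝ) 0 with h | h
    · simp [h]
    · rw [Real.log_div h hM0.ne', hM, Real.log_pow]
      ring
  have hone : ∑ t, (#(T t) : ℝ) / M = 1 := by
    simp_rw [← hlaw]
    exact sum_law g
  calc _ = ∑ t, (∑ i, (#(T t) - 2 * √(coordCount (T t) i false * coordCount (T t) i true)) / 2)
            / M := by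
        simp_rw [sum_div]
        rw [sum_comm]
        refine sum_congr rfl fun i _ => ?_
        simp_rw [hsqrt]
        nth_rewrite 1 [← hone]
        rw [← sum_sub_distrib, sum_div]
        exact sum_congr rfl fun t _ => by ring
    _ ≤ _ := by
        refine sum_le_sum fun t _ => ?_
        rw [hent]
        gcongr
        exact sum_sub_sqrt_le_card_mul_log (T t)

/-- Conditioning on a uniform variable does not increase entropy. -/
lemma expect_sum_negMulLog_le [Fintype τ] [Nonempty κ] (p : κ → τ → ℝ)
    (hp : ∀ w t, 0 ≤ p w t) :
    𝔼 w, ∑ t, Real.negMulLog (p w t) ≤ ∑ t, Real.negMulLog (𝔼 w, p w t) := by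
  rw [expect_sum_comm]
  refine sum_le_sum fun t _ => ?_
  have hc : (0 : ℝ) < Fintype.card κ := by exact_mod_cast Fintype.card_pos
  have := Real.concaveOn_negMulLog.le_map_sum (t := univ)
    (w := fun _ : κ => (Fintype.card κ : ℝ)⁻¹) (p := fun w => p w t)
    (fun _ _ => by positivity) (by simp) (fun w _ => hp w t)
  rw [Fintype.expect_eq_sum_div_card, Fintype.expect_eq_sum_div_card]
  simpa [← mul_sum, div_eq_inv_mul] using this

end Expectation

/-! ### Rectangle structure of protocol leaves. -/

namespace Protocol

variable {k : ℕ} {X : Type}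

lemma mem_leafRect_self (C : Protocol k X) (x : Fin k → X) : x ∈ C.leafRect x := by
  induction C with
  | leaf out => exact Set.mem_univ _
  | node j f C₀ C₁ h₀ h₁ =>
    refine ⟨rfl, ?_⟩
    split_ifs
    exacts [h₁, h₀]

lemma leafRect_eq_of_mem (C : Protocol k X) {x y : Fin k → X} (h : y ∈ C.leafRect x) :
    C.leafRect y = C.leafRect x := by
  induction C with
  | leaf out => rfl
  | node j f C₀ C₁ h₀ h₁ =>
    obtain ⟨hf, h⟩ := h
    simp only [Set.mem_ofPred_eq] at hf
    simp only [leafRect, hf]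
    split_ifs at h ⊢ with hx
    · rw [h₁ h]
    · rw [h₀ h]

lemma output_eq_of_mem (C : Protocol k X) {x y : Fin k → X} (h : y ∈ C.leafRect x) :
    C.output y = C.output x := by
  induction C with
  | leaf out => rfl
  | node j f C₀ C₁ h₀ h₁ =>
    obtain ⟨hf, h⟩ := h
    simp only [Set.mem_ofPred_eq] at hf
    simp only [output, hf]
    split_ifs at h ⊢ with hx
    · rw [h₁ h]
    · rw [h₀ h]

lemma output_eq_of_leafRect_eq (C : Protocol k X) {x y : Fin k → X}
    (h : C.leafRect y = C.leafRect x) : C.output y = C.output x :=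
  C.output_eq_of_mem (h ▸ C.mem_leafRect_self y)

lemma leafRect_eq_pi (C : Protocol k X) (x : Fin k → X) :
    ∃ S : Fin k → Set X, ∀ z, z ∈ C.leafRect x ↔ ∀ j, z j ∈ S j := by
  induction C with
  | leaf out => exact ⟨fun _ => Set.univ, by simp [leafRect]⟩
  | node j f C₀ C₁ h₀ h₁ =>
    have key : ∀ R : Set (Fin k → X), (∃ S : Fin k → Set X, ∀ z, z ∈ R ↔ ∀ j, z j ∈ S j) →
        ∃ S : Fin k → Set X, ∀ z, z ∈ {y | f (y j) = f (x j)} ∩ R ↔ ∀ j, z j ∈ S j := by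
      rintro R ⟨S, hS⟩
      refine ⟨fun i => S i ∩ {y | i = j → f y = f (x j)}, fun z => ?_⟩
      simp only [Set.mem_inter_iff, Set.mem_ofPred_eq, hS]
      constructor
      · rintro ⟨h1, h2⟩ i
        exact ⟨h2 i, fun hi => hi ▸ h1⟩
      · intro h
        exact ⟨(h j).2 rfl, fun i => (h i).1⟩
    simp only [leafRect]
    split_ifs
    exacts [key _ h₁, key _ h₀]

/-- A leaf rectangle is its own fiber. Any other set has empty fiber, which is a product of empty
sides because there is at least one party. -/
lemma leafRect_fiber_eq_pi [NeZero k] (C : Protocol k X) (t : Set (Fin k → X)) :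
    ∃ S : Fin k → Set X, ∀ z, C.leafRect z = t ↔ ∀ j, z j ∈ S j := by
  by_cases h : ∃ x, C.leafRect x = t
  · obtain ⟨x, rfl⟩ := h
    obtain ⟨S, hS⟩ := C.leafRect_eq_pi x
    refine ⟨S, fun z => ?_⟩
    rw [← hS]
    exact ⟨fun hz => hz ▸ C.mem_leafRect_self z, C.leafRect_eq_of_mem⟩
  · push Not at h
    refine ⟨fun _ => ∅, fun z => ?_⟩
    simp [h z]

end Protocol

/-! ### Inputs with a prescribed column. -/

section Inputs

variable {n k : ℕ}

/-- The no instance determined by the hidden choices `w` and the bits `a`. -/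
def hiddenInput (w : Fin n → Fin k) (a : Fin n → Bool) : Input n k :=
  fun j i => decide (w i = j) && a i

/-- The row of party `j` in the input `placeInput i w u a` when `u j = b`. -/
def placeRow (i : Fin n) (w : Fin n → Fin k) (j : Fin k) (b : Bool) (a : Fin n → Bool) :
    Fin n → Bool :=
  fun i' => if i' = i then b else decide (w i' = j) && a i'

/-- The input with `u` at position `i` and the hidden choices `w`, `a` elsewhere. -/
def placeInput (i : Fin n) (w : Fin n → Fin k) (u : Fin k → Bool) (a : Fin n → Bool) :
    Input n k :=
  fun j => placeRow i w j (u j) a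

lemma sampleInput_false (w : Fin n → Fin k) (a : Fin n → Bool) (l : Fin n) :
    sampleInput (w, a, false, l) = hiddenInput w a := by
  ext j i
  simp [sampleInput, hiddenInput, partyChoice, presence, plantBit]

lemma sampleInput_true (w : Fin n → Fin k) (a : Fin n → Bool) (l : Fin n) :
    sampleInput (w, a, true, l) = placeInput l w (fun _ => true) a := by
  ext j i
  by_cases h : i = l <;>
    simp [sampleInput, placeInput, placeRow, partyChoice, presence, plantBit, plantPos, h]

lemma hiddenInput_update_false (i : Fin n) (w : Fin n → Fin k) (a : Fin n → Bool) :
    hiddenInput w (Function.update a i false) = placeInput i w (fun _ => false) a := by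
  ext j i'
  by_cases h : i' = i
  · subst h
    simp [hiddenInput, placeInput, placeRow]
  · simp [hiddenInput, placeInput, placeRow, h]

lemma hiddenInput_update_true (i : Fin n) (w : Fin n → Fin k) (a : Fin n → Bool) :
    hiddenInput w (Function.update a i true)
      = placeInput i w (fun j => decide (j = w i)) a := by
  ext j i'
  by_cases h : i' = i
  · subst h
    simp [hiddenInput, placeInput, placeRow, eq_comm]
  · simp [hiddenInput, placeInput, placeRow, h]

/-- Column i is overwritten by u, so the hidden choice at i is irrelevant and can be resampled. -/
lemma placeInput_update (i : Fin n) (w : Fin n → Fin k) (j : Fin k) :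
    placeInput i (Function.update w i j) = placeInput i w := by
  ext u a j' i'
  by_cases h : i' = i <;> simp [placeInput, placeRow, h]

/-- A planted element lies in k ≥ 2 sets, an unplanted one at most in the set of its chosen party.
-/
lemma eq_plantBit_of_isUDisjValue (hk : 2 ≤ k) (ω : Coins n k) {b : Bool}
    (h : IsUDisjValue (sampleInput ω) b) : b = plantBit ω := by
  obtain ⟨w, a, B, l⟩ := ω
  change b = B
  rcases h with ⟨h, rfl⟩ | ⟨⟨m, h, -⟩, rfl⟩
  · cases B
    · rfl
    · exfalso
      have := h l
      rw [sampleInput_true] at this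
      simp [placeInput, placeRow] at this
      omega
  · cases B
    · exfalso
      rw [sampleInput_false] at h
      have h0 := h ⟨0, by omega⟩
      have h1 := h ⟨1, by omega⟩
      simp only [hiddenInput, Bool.and_eq_true, decide_eq_true_eq] at h0 h1
      have := h0.1.symm.trans h1.1
      simp at this
    · rfl

end Inputs

/-! ### Cut-and-paste and the entropy of transcripts. -/

section Transcripts

open Finset
open scoped BigOperators

variable {n k : ℕ} {τ : Type*} [DecidableEq τ]

/-- The law of `g x` when the input `x` is `u` at position `i` and the bits elsewhere are
random. -/
noncomputable def placeLaw (g : Input n k → τ) (i : Fin n) (w : Fin n → Fin k)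
    (u : Fin k → Bool) (t : τ) : ℝ :=
  law (fun a => g (placeInput i w u a)) t

/-- The cut-and-paste property of transcripts with rectangular fibers. -/
lemma exists_placeLaw_eq_prod (g : Input n k → τ)
    (hg : ∀ t, ∃ S : Fin k → Set (Fin n → Bool), ∀ z, g z = t ↔ ∀ j, z j ∈ S j)
    (i : Fin n) (w : Fin n → Fin k) :
    ∃ q : Fin k → Bool → τ → ℝ, (∀ j b t, 0 ≤ q j b t) ∧
      ∀ u t, placeLaw g i w u t = ∏ j, q j (u j) t := by
  classical
  choose S hS using hg
  -- Party j contributes the probability that its row lies in its side of the rectangle; the rows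
  -- read disjoint blocks of bits.
  refine ⟨fun j b t => 𝔼 a, if placeRow i w j b a ∈ S t j then 1 else 0,
    fun j b t => expect_nonneg fun a _ => by split_ifs <;> norm_num, fun u t => ?_⟩
  rw [← expect_prod_of_blocks w
    (fun j a => if placeRow i w j (u j) a ∈ S t j then (1 : ℝ) else 0)]
  · refine expect_congr rfl fun a _ => ?_
    rw [prod_boole]
    simp [hS, placeInput]
  · intro j a a' h
    have : placeRow i w j (u j) a = placeRow i w j (u j) a' := by
      ext i'
      unfold placeRow
      by_cases hi : w i' = j
      · rw [h i' hi]
      · simp [hi]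
    simp only [this]

/-- The entropy (in nats) of a transcript with rectangular fibers on a random no instance, in terms
of its behaviour on `0` and `1` planted at a random position. -/
lemma sum_expect_sub_le_entropy [Fintype τ] [NeZero k] (g : Input n k → τ)
    (hg : ∀ t, ∃ S : Fin k → Set (Fin n → Bool), ∀ z, g z = t ↔ ∀ j, z j ∈ S j)
    (T : Finset τ) :
    ∑ i, 𝔼 w, (∑ t ∈ T, placeLaw g i w (fun _ => false) t
        - 2 * ∑ t ∈ T, placeLaw g i w (fun _ => true) t) / (640 * k)
      ≤ ∑ t, Real.negMulLog (𝔼 w, law (fun a => g (hiddenInput w a)) t) := by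
  have hk : (0 : ℝ) < k := by exact_mod_cast Nat.pos_of_ne_zero (NeZero.ne k)
  set D : Fin n → (Fin n → Fin k) → Fin k → ℝ := fun i w j =>
    1 - ∑ t, √(placeLaw g i w (fun _ => false) t
      * placeLaw g i w (fun i' => decide (i' = j)) t) with hD
  have hDu : ∀ i w j j', D i (Function.update w i j) j' = D i w j' := fun i w j j' => by
    simp only [hD, placeLaw, placeInput_update]
  -- Here 640 k combines the constant 320, the halved distances and the mean over k parties.
  calc _ ≤ ∑ i, 𝔼 w, 𝔼 j, D i w j / 2 := by
        refine sum_le_sum fun i _ => expect_le_expect fun w _ => ?_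
        obtain ⟨q, hq, hP⟩ := exists_placeLaw_eq_prod g hg i w
        have := sum_sub_two_mul_le (placeLaw g i w) q hq hP (fun u => sum_law _) T
        rw [Fintype.expect_eq_sum_div_card, ← sum_div, Fintype.card_fin, div_div,
          div_le_div_iff₀ (by positivity) (by positivity)]
        nlinarith
    _ = ∑ i, 𝔼 w, D i w (w i) / 2 := by
        refine sum_congr rfl fun i _ => ?_
        rw [← expect_update i (fun w => D i w (w i) / 2)]
        refine expect_congr rfl fun w _ => expect_congr rfl fun j _ => ?_
        rw [hDu, Function.update_self]
    _ = 𝔼 w, ∑ i, D i w (w i) / 2 := (expect_sum_comm _ _ _).symm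
    _ ≤ 𝔼 w, ∑ t, Real.negMulLog (law (fun a => g (hiddenInput w a)) t) := by
        refine expect_le_expect fun w _ => ?_
        have := sum_one_sub_le_sum_negMulLog_law (fun a => g (hiddenInput w a))
        simpa only [hD, placeLaw, hiddenInput_update_false, hiddenInput_update_true] using this
    _ ≤ _ := expect_sum_negMulLog_le _ fun w t => law_nonneg _ t

end Transcripts

/-! ### Correctness under the hard distribution and the final bound. -/

section HardDistribution

open Finset
open scoped BigOperators

variable {n k : ℕ}

open scoped Classical in
lemma coinLaw_real (S : Set (Coins n k)) :
    (coinLaw n k).real S = 𝔼 ω : Coins n k, if ω ∈ S then (1 : ℝ) else 0 := by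
  rw [measureReal_def, coinLaw, uniformOn_univ, Measure.count_apply MeasurableSet.of_discrete,
    Fintype.expect_eq_sum_div_card, ENNReal.toReal_div, ENNReal.toReal_natCast]
  simp [Set.encard_eq_coe_toFinset_card, Set.toFinset_card, Fintype.card_subtype]

lemma expect_coins (F : Coins n k → ℝ) :
    𝔼 ω, F ω = 𝔼 l, 𝔼 w, 𝔼 a, (F (w, a, true, l) + F (w, a, false, l)) / 2 := by
  let e : Fin n × (Fin n → Fin k) × (Fin n → Bool) × Bool ≃ Coins n k :=
    ⟨fun x => (x.2.1, x.2.2.1, x.2.2.2, x.1), fun ω => (ω.2.2.2, ω.1, ω.2.1, ω.2.2.1),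
      fun _ => rfl, fun _ => rfl⟩
  rw [← Fintype.expect_equiv e (fun x => F (x.2.1, x.2.2.1, x.2.2.2, x.1)) F fun _ => rfl,
    ← univ_product_univ, expect_product]
  refine expect_congr rfl fun l _ => ?_
  rw [← univ_product_univ, expect_product]
  refine expect_congr rfl fun w _ => ?_
  rw [← univ_product_univ, expect_product]
  refine expect_congr rfl fun a _ => ?_
  rw [Fintype.expect_eq_sum_div_card, Fintype.sum_bool, Fintype.card_bool]
  norm_num

/-- The law of a function of the input under `Q`. -/
lemma noCoinLaw_real_preimage [NeZero n] {τ : Type*} [DecidableEq τ] (g : Input n k → τ) (t : τ) :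
    (noCoinLaw n k).real ((fun ω => g (sampleInput ω)) ⁻¹' {t})
      = 𝔼 w, law (fun a => g (hiddenInput w a)) t := by
  classical
  rcases isEmpty_or_nonempty (Fin n → Fin k) with h | h
  · have : IsEmpty (Coins n k) := ⟨fun ω => h.elim ω.1⟩
    simp [Set.eq_empty_of_isEmpty]
  have h1 : (coinLaw n k).real {ω | plantBit ω = false} = 1 / 2 := by
    rw [coinLaw_real, expect_coins]
    simp [plantBit]
  rw [measureReal_def, noCoinLaw, cond_apply MeasurableSet.of_discrete, ENNReal.toReal_mul,
    ENNReal.toReal_inv, ← measureReal_def, ← measureReal_def, h1, coinLaw_real, expect_coins]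
  simp only [plantBit, Set.mem_inter_iff, Set.mem_ofPred_eq, Set.mem_preimage,
    Set.mem_singleton_iff, sampleInput_false, Bool.true_eq_false, false_and, if_false, true_and,
    zero_add, ← expect_div]
  rw [expect_const univ_nonempty]
  simp only [law]
  ring

open scoped Classical in
/-- The output of a correct protocol distinguishes `0` from `1` at a random position. -/
lemma le_expect_sub_of_correct (hk : 2 ≤ k) [NeZero n] (C : Protocol k (Fin n → Bool)) (ε : ℝ)
    (hC : 1 - ε ≤ (hardP n k).real {x | IsUDisjValue x (C.output x)}) :
    1 - 4 * ε ≤ 𝔼 i, 𝔼 w,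
      ((𝔼 a, if C.output (placeInput i w (fun _ => false) a) = false then (1 : ℝ) else 0)
        - 2 * 𝔼 a, if C.output (placeInput i w (fun _ => true) a) = false then (1 : ℝ) else 0)
      := by
  have : NeZero k := ⟨by omega⟩
  have hle : (hardP n k).real {x | IsUDisjValue x (C.output x)}
      ≤ (coinLaw n k).real {ω | C.output (sampleInput ω) = plantBit ω} := by
    have : IsFiniteMeasure (coinLaw n k) := by unfold coinLaw; infer_instance
    rw [measureReal_def, hardP, Measure.map_apply (measurable_of_finite _) MeasurableSet.of_discrete,
      ← measureReal_def]
    exact measureReal_mono fun ω hω => eq_plantBit_of_isUDisjValue hk ω hω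
  rw [coinLaw_real, expect_coins] at hle
  simp only [plantBit, Set.mem_ofPred_eq, sampleInput_false, sampleInput_true] at hle
  -- When B = 0, the bit at l is 0 half of the time; the other half is bounded trivially by 1. The
  -- event of placing 0 thus has weight 1/4 against 1/2 for B = 1, which explains the factor 2.
  have hlw : ∀ (l : Fin n) (w : Fin n → Fin k),
      𝔼 a, ((if C.output (placeInput l w (fun _ => true) a) = true then (1 : ℝ) else 0)
          + if C.output (hiddenInput w a) = false then 1 else 0) / 2
        ≤ 3 / 4 + ((𝔼 a, if C.output (placeInput l w (fun _ => false) a) = false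
            then (1 : ℝ) else 0)
          - 2 * 𝔼 a, if C.output (placeInput l w (fun _ => true) a) = false
            then (1 : ℝ) else 0) / 4 := by
    intro l w
    rw [← expect_div, expect_add_distrib]
    have h1 : 𝔼 a, (if C.output (placeInput l w (fun _ => true) a) = true then (1 : ℝ) else 0)
        = 1 - 𝔼 a, if C.output (placeInput l w (fun _ => true) a) = false
            then (1 : ℝ) else 0 := by
      rw [eq_sub_iff_add_eq, ← expect_add_distrib]
      refine (expect_congr rfl fun a _ => ?_).trans (expect_const univ_nonempty _)
      cases C.output (placeInput l w (fun _ => true) a) <;> simp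
    have h2 : 𝔼 a, (if C.output (hiddenInput w a) = false then (1 : ℝ) else 0)
        ≤ 𝔼 a, ((if C.output (placeInput l w (fun _ => false) a) = false
            then (1 : ℝ) else 0) / 2 + 1 / 2) := by
      rw [← expect_update l]
      refine expect_le_expect fun a _ => ?_
      rw [Fintype.expect_eq_sum_div_card, Fintype.sum_bool, Fintype.card_bool,
        hiddenInput_update_false]
      split_ifs <;> norm_num
    rw [expect_add_distrib, ← expect_div, expect_const univ_nonempty] at h2
    linarith
  have h := hC.trans (hle.trans
    (expect_le_expect fun l _ => expect_le_expect fun w _ => hlw l w))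
  simp_rw [expect_add_distrib, ← expect_div] at h
  rw [expect_const univ_nonempty, expect_const univ_nonempty] at h
  linarith

lemma entropy_eq_sum_negMulLog {Ω α : Type*} [MeasurableSpace Ω] [Fintype α] (μ : Measure Ω)
    (X : Ω → α) : entropy μ X = (∑ a, Real.negMulLog (μ.real (X ⁻¹' {a}))) / Real.log 2 := by
  rw [entropy, sum_div]
  refine sum_congr rfl fun a _ => ?_
  rw [Real.negMulLog, Real.logb, one_div, Real.log_inv]
  ring

lemma infoCost_eq_entropy (C : Protocol k (Fin n → Bool)) :
    infoCost C = entropy (noCoinLaw n k) fun ω => C.leafRect (sampleInput ω) := by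
  have : IsFiniteMeasure (noCoinLaw n k) := by unfold noCoinLaw; infer_instance
  exact mutualInfo_comp (noCoinLaw n k)
    (fun ω => ((sampleInput ω, partyChoice ω) : Input n k × (Fin n → Fin k)))
    (fun y => C.leafRect y.1)

lemma div_le_infoCost (hn : 1 ≤ n) (hk : 2 ≤ k) (C : Protocol k (Fin n → Bool)) {ε : ℝ}
    (hε : ε < 0.0001) (hC : 1 - ε ≤ (hardP n k).real {x | IsUDisjValue x (C.output x)}) :
    1 / 800 * ((n : ℝ) / k) ≤ infoCost C := by
  classical
  have : NeZero n := ⟨by omega⟩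
  have : NeZero k := ⟨by omega⟩
  have hk0 : (0 : ℝ) < k := by exact_mod_cast (by omega : 0 < k)
  have hn0 : (0 : ℝ) < n := by exact_mod_cast (by omega : 0 < n)
  set g : Input n k → Set (Input n k) := C.leafRect with hg
  -- The output is constant on each leaf rectangle, so T determines it.
  set T : Finset (Set (Input n k)) := {t | ∃ x, g x = t ∧ C.output x = false} with hT
  have hmem : ∀ x, g x ∈ T ↔ C.output x = false := by
    intro x
    simp only [hT, mem_filter, mem_univ, true_and]
    constructor
    · rintro ⟨y, hy, h⟩
      rw [← h]
      exact C.output_eq_of_leafRect_eq hy.symm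
    · exact fun h => ⟨x, rfl, h⟩
  have hplace : ∀ i w u, ∑ t ∈ T, placeLaw g i w u t
      = 𝔼 a, if C.output (placeInput i w u a) = false then (1 : ℝ) else 0 := by
    intro i w u
    simp only [placeLaw, sum_law_mem, hmem]
  have h1 := sum_expect_sub_le_entropy g C.leafRect_fiber_eq_pi T
  have h2 := le_expect_sub_of_correct hk C ε hC
  simp only [hplace, ← expect_div] at h1
  rw [← sum_div] at h1
  rw [Fintype.expect_eq_sum_div_card, Fintype.card_fin, le_div_iff₀ hn0] at h2
  rw [infoCost_eq_entropy, entropy_eq_sum_negMulLog]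
  simp_rw [noCoinLaw_real_preimage]
  have h3 : 1 / 800 * ((n : ℝ) / k)
      ≤ ∑ t, Real.negMulLog (𝔼 w, law (fun a => g (hiddenInput w a)) t) := by
    refine le_trans ?_ h1
    rw [le_div_iff₀ (by positivity)]
    refine le_trans ?_ h2
    -- The constant 1/800 needs only 1 - 4ε ≥ 4/5.
    rw [show 1 / 800 * ((n : ℝ) / k) * (640 * k) = 4 / 5 * n by field_simp; norm_num]
    norm_num at hε
    gcongr
    linarith
  have hlog : 0 < Real.log 2 := Real.log_pos one_lt_two
  -- Since log 2 ≤ 1, passing from nats to bits preserves the bound.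
  have hlog1 : Real.log 2 ≤ 1 := by
    have := Real.log_le_sub_one_of_pos (x := 2) two_pos
    linarith
  have h0 : 0 ≤ 1 / 800 * ((n : ℝ) / k) := by positivity
  rw [le_div_iff₀ hlog]
  nlinarith

end HardDistribution

end UDisj

theorem theorem5 :
    ∃ c : ℝ, 0 < c ∧
      ∀ ε : ℝ, 0 < ε → ε < 0.0001 →
      ∀ n k : ℕ, 1 ≤ n → 2 ≤ k →
      ∀ C : UDisj.Protocol k (Fin n → Bool),
        1 - ε ≤ (UDisj.hardP n k).real {x | UDisj.IsUDisjValue x (C.output x)} →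
        c * ((n : ℝ) / (k : ℝ)) ≤ UDisj.infoCost C :=
  ⟨1 / 800, by norm_num, fun _ _ hε _ _ hn hk C hC => UDisj.div_le_infoCost hn hk C hε hC⟩
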